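/- For a reproducing kernel Hilbert space $\mathcal M$ of functions on a set $X$ with kernel $k$, containing the constant function $1$, let $$\mathcal M\odot\mathcal M=\Big\{\sum_{n}f_ng_n:\ f_n,g_n\in\mathcal M,\ \sum_n\|f_n\|\,\|g_n\|<\infty\Big\},$$ where the norm of $h$ is the infimum of $\sum_n\|f_n\|\,\|g_n\|$ over all representations $h=\sum_n f_ng_n$. Let $\rho:\mathcal M\otimes_\pi\mathcal M\to\mathcal M\odot\mathcal M$ be the map $\sum f_n\otimes g_n\mapsto\sum f_ng_n$ on the projective tensor product, whose dual is identified with the space $\mathcal B(\mathcal M,\overline{\mathcal M})$ of bounded linear operators from $\mathcal M$ to its complex conjugate space. Put $$\mathrm{Han}(k)=\{\overline{T1}:\ T\in(\ker\rho)^\perp\subseteq\mathcal B(\mathcal M,\overline{\mathcal M})\},$$ where the norm of $b=\overline{T1}$ is the operator norm of $T$ (when the multipliers of $\mathcal M$ are densely contained in $\mathcal M$, as is the case below, $T$ is determined by $b$). For $1\le p<\infty$ let $$\mathcal H^p(k)=[\mathcal M\odot\mathcal M,\ \mathrm{Han}(k)]_{[\theta]},\qquad \theta=\frac{p-1}{p},$$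 be the space obtained by Calderón's complex method of interpolation. Let $s(z,w)=\frac1{1-z\overline w}$ be the Szegő kernel on the open unit disc $\mathbb D\subset\mathbb C$ and, for a cardinal number $d$, let $S(z,w)=\frac1{1-\langle z,w\rangle}$ be the Drury--Arveson kernel on the open unit ball $\mathbb B_d$ of $\ell^2(d)$. **Lemma.** Let $d$ be a cardinal number, let $v\in\ell^2(d)$ be a unit vector and let $Q:\ell^2(d)\to\mathbb C$, $z\mapsto\langle z,v\rangle$. Then for every $1\le p<\infty$ the map $$\mathcal H^p(s)\to\mathcal H^p(S),\qquad f\mapsto f\circ Q,$$ is a (well-defined, linear) isometry onto a complemented subspace of $\mathcal H^p(S)$, i.e. its range is the range of a bounded linear projection on $\mathcal H^p(S)$. Similarly, the map $$\mathrm{Han}(s)\to\mathrm{Han}(S),\qquad f\mapsto f\circ Q,$$ is an isometry onto a complemented subspace of $\mathrm{Han}(S)$. -/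

import Mathlib

noncomputable section

/-! ### Normed spaces of functions -/

/-- A normed space of complex functions on `X`: a linear space of functions with a seminorm for
which all point evaluations are bounded (so that the seminorm is in fact a norm). -/
structure NormedFunctionSpace (X : Type*) where
  /-- The functions that belong to the space. -/
  carrier : Submodule ℂ (X → ℂ)
  /-- The norm. -/
  nrm : Seminorm ℂ carrier
  /-- Point evaluations are bounded. -/
  eval_bound : ∀ x : X, ∃ C : ℝ, ∀ f : carrier, ‖(f : X → ℂ) x‖ ≤ C * nrm f

namespace NormedFunctionSpace

variable {X : Type*}

/-- The elements of a normed function space, as a type carrying that norm (and not the topology of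
pointwise convergence). -/
def Elem (A : NormedFunctionSpace X) : Type _ := A.carrier

instance (A : NormedFunctionSpace X) : AddCommGroup A.Elem :=
  inferInstanceAs (AddCommGroup A.carrier)

instance (A : NormedFunctionSpace X) : Module ℂ A.Elem :=
  inferInstanceAs (Module ℂ A.carrier)

instance (A : NormedFunctionSpace X) : FunLike A.Elem X ℂ where
  coe f := Subtype.val (p := (· ∈ A.carrier)) f
  coe_injective := Subtype.val_injective

@[ext]
theorem Elem.ext {A : NormedFunctionSpace X} {f g : A.Elem} (h : ∀ x, f x = g x) : f = g :=
  DFunLike.ext f g h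

@[simp]
theorem add_apply {A : NormedFunctionSpace X} (f g : A.Elem) (x : X) :
    (f + g) x = f x + g x := rfl

@[simp]
theorem smul_apply {A : NormedFunctionSpace X} (c : ℂ) (f : A.Elem) (x : X) :
    (c • f) x = c * f x := rfl

@[simp]
theorem zero_apply {A : NormedFunctionSpace X} (x : X) : (0 : A.Elem) x = 0 := rfl

instance (A : NormedFunctionSpace X) : NormedAddCommGroup A.Elem :=
  AddGroupNorm.toNormedAddCommGroup
    { toFun := fun f => A.nrm f
      map_zero' := map_zero A.nrm
      add_le' := map_add_le_add A.nrm
      neg' := map_neg_eq_map A.nrm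
      eq_zero_of_map_eq_zero' := fun f hf => by
        refine Elem.ext fun x => ?_
        obtain ⟨C, hC⟩ := A.eval_bound x
        have h := hC f
        rw [hf, mul_zero] at h
        exact norm_le_zero_iff.1 h }

theorem norm_def (A : NormedFunctionSpace X) (f : A.Elem) : ‖f‖ = A.nrm f := rfl

instance (A : NormedFunctionSpace X) : NormedSpace ℂ A.Elem where
  norm_smul_le c f := (map_smul_eq_mul A.nrm c f).le

/-- Evaluation at a point, as a bounded linear functional. -/
def evalCLM (A : NormedFunctionSpace X) (x : X) : A.Elem →L[ℂ] ℂ :=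
  LinearMap.mkContinuousOfExistsBound
    { toFun := fun f => f x
      map_add' := fun _ _ => rfl
      map_smul' := fun _ _ => rfl } (A.eval_bound x)

@[simp]
theorem evalCLM_apply (A : NormedFunctionSpace X) (x : X) (f : A.Elem) : A.evalCLM x f = f x := rfl

/-- The function space determined by a notion of representation: `R a c` means that the function
`a` has a representation of cost `c`. The space consists of the functions that have some
representation, and the norm of a function is the infimum of the costs of its representations. -/
def ofCost (R : (X → ℂ) → ℝ → Prop)
    (nonneg : ∀ a c, R a c → 0 ≤ c)
    (zero : R 0 0)
    (add : ∀ a b c d, R a c → R b d → ∃ e ≤ c + d, R (a + b) e)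
    (smul : ∀ (l : ℂ) a c, R a c → ∃ e ≤ ‖l‖ * c, R (l • a) e)
    (eval : ∀ x, ∃ C : ℝ, 0 ≤ C ∧ ∀ a c, R a c → ‖a x‖ ≤ C * c) :
    NormedFunctionSpace X where
  carrier :=
    { carrier := {a | ∃ c, R a c}
      add_mem' := fun {a b} ⟨c, hc⟩ ⟨d, hd⟩ => by
        obtain ⟨e, -, he⟩ := add a b c d hc hd
        exact ⟨e, he⟩
      zero_mem' := ⟨0, zero⟩
      smul_mem' := fun l a ⟨c, hc⟩ => by
        obtain ⟨e, -, he⟩ := smul l a c hc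
        exact ⟨e, he⟩ }
  nrm := Seminorm.ofSMulLE (fun a => sInf {c | R a.1 c})
    (le_antisymm (csInf_le ⟨0, fun c hc => nonneg _ c hc⟩ zero)
      (Real.sInf_nonneg fun c hc => nonneg _ c hc))
    (fun a b => by
      refine le_of_forall_pos_lt_add fun ε hε => ?_
      obtain ⟨c, hc, hc'⟩ := Real.lt_sInf_add_pos (s := {c | R a.1 c}) a.2 (half_pos hε)
      obtain ⟨d, hd, hd'⟩ := Real.lt_sInf_add_pos (s := {c | R b.1 c}) b.2 (half_pos hε)
      obtain ⟨e, hle, he⟩ := add _ _ c d hc hd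
      have h : sInf {c | R (a + b).1 c} ≤ e := csInf_le ⟨0, fun c hc => nonneg _ c hc⟩ he
      linarith)
    (fun l a => by
      refine le_of_forall_pos_le_add fun ε hε => ?_
      have hpos : 0 < ‖l‖ + 1 := by positivity
      obtain ⟨c, hc, hc'⟩ := Real.lt_sInf_add_pos (s := {c | R a.1 c}) a.2 (div_pos hε hpos)
      obtain ⟨e, hle, he⟩ := smul l _ c hc
      have h : sInf {c | R (l • a).1 c} ≤ e := csInf_le ⟨0, fun c hc => nonneg _ c hc⟩ he
      have h1 : ‖l‖ * c ≤ ‖l‖ * (sInf {c | R a.1 c} + ε / (‖l‖ + 1)) := by gcongr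
      have h2 : ‖l‖ * (ε / (‖l‖ + 1)) ≤ ε := by
        rw [mul_div_assoc', div_le_iff₀ hpos]
        nlinarith
      linarith)
  eval_bound := fun x => by
    obtain ⟨C, hC0, hC⟩ := eval x
    refine ⟨C, fun f => ?_⟩
    change _ ≤ C * sInf {c | R f.1 c}
    refine le_of_forall_pos_le_add fun ε hε => ?_
    have hpos : 0 < C + 1 := by positivity
    obtain ⟨c, hc, hc'⟩ := Real.lt_sInf_add_pos (s := {c | R f.1 c}) f.2 (div_pos hε hpos)
    have h1 : C * c ≤ C * (sInf {c | R f.1 c} + ε / (C + 1)) := by gcongr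
    have h2 : C * (ε / (C + 1)) ≤ ε := by
      rw [mul_div_assoc', div_le_iff₀ hpos]
      nlinarith
    have := hC _ c hc
    linarith

/-! ### The complex method of interpolation -/

/-- The bound of a point evaluation, written with the norm of `Elem`. -/
theorem exists_eval_bound (A : NormedFunctionSpace X) (x : X) :
    ∃ C : ℝ, 0 ≤ C ∧ ∀ f : A.Elem, ‖f x‖ ≤ C * ‖f‖ :=
  ⟨‖A.evalCLM x‖, norm_nonneg _, (A.evalCLM x).le_opNorm⟩

/-- The sum `A + B` with the norm `inf {‖a‖ + ‖b‖}`, over all `a ∈ A` and `b ∈ B` with sum `f`. -/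
def sum (A B : NormedFunctionSpace X) : NormedFunctionSpace X :=
  ofCost (fun f c => ∃ (a : A.Elem) (b : B.Elem), (∀ x, f x = a x + b x) ∧ c = ‖a‖ + ‖b‖)
    (by
      rintro f c ⟨a, b, -, rfl⟩
      positivity)
    ⟨0, 0, by simp, by simp⟩
    (by
      rintro f g c d ⟨a, b, h, rfl⟩ ⟨a', b', h', rfl⟩
      refine ⟨‖a + a'‖ + ‖b + b'‖, ?_, a + a', b + b', fun x => ?_, rfl⟩
      · linarith [norm_add_le a a', norm_add_le b b']
      · simp only [Pi.add_apply, h, h', add_apply]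
        ring)
    (by
      rintro l f c ⟨a, b, h, rfl⟩
      refine ⟨‖l • a‖ + ‖l • b‖, ?_, l • a, l • b, fun x => ?_, rfl⟩
      · rw [norm_smul, norm_smul, mul_add]
      · simp [h, mul_add])
    (by
      intro x
      obtain ⟨C, hC0, hC⟩ := A.exists_eval_bound x
      obtain ⟨D, hD0, hD⟩ := B.exists_eval_bound x
      refine ⟨C + D, by positivity, ?_⟩
      rintro f c ⟨a, b, h, rfl⟩
      rw [h]
      refine (norm_add_le _ _).trans ?_
      nlinarith [hC a, hD b, mul_nonneg hC0 (norm_nonneg b), mul_nonneg hD0 (norm_nonneg a)])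

/-- Admissible functions of the complex method for the couple `(A, B)`: functions on the closed
strip `0 ≤ Re z ≤ 1` with values in `A + B` that are bounded and continuous there, are
analytic in the open strip, and whose restrictions to the lines `Re z = 0` and `Re z = 1` are
continuous functions into `A` and into `B` that vanish at infinity. Those restrictions are
`G₀` and `G₁`; the norms of `C₀(ℝ, A)` and `C₀(ℝ, B)` are the supremum norms. -/
def IsAdmissible (A B : NormedFunctionSpace X) (F : ℂ → (A.sum B).Elem)
    (G₀ : ZeroAtInftyContinuousMap ℝ A.Elem) (G₁ : ZeroAtInftyContinuousMap ℝ B.Elem) : Prop :=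
  DiffContOnCl ℂ F (Complex.re ⁻¹' Set.Ioo 0 1) ∧
  (∃ C : ℝ, ∀ z : ℂ, 0 ≤ z.re → z.re ≤ 1 → ‖F z‖ ≤ C) ∧
  (∀ (t : ℝ) (x : X), F (t * Complex.I) x = G₀ t x) ∧
  (∀ (t : ℝ) (x : X), F (1 + t * Complex.I) x = G₁ t x)

theorem norm_coe_le {E : Type*} [NormedAddCommGroup E] (G : ZeroAtInftyContinuousMap ℝ E) (t : ℝ) :
    ‖G t‖ ≤ ‖G‖ := by
  rw [← ZeroAtInftyContinuousMap.norm_toBCF_eq_norm]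
  exact G.toBCF.norm_coe_le_norm t

/-- The complex interpolation space `[A, B]_[θ]`: it consists of the values `F θ` of admissible
functions, and the norm of `a` is the infimum of
`max (sup_t ‖F (it)‖_A) (sup_t ‖F (1 + it)‖_B)` over all admissible `F` with `F θ = a`. -/
def interpolation (A B : NormedFunctionSpace X) (θ : unitInterval) : NormedFunctionSpace X :=
  ofCost (fun a c => ∃ F G₀ G₁, IsAdmissible A B F G₀ G₁ ∧ (∀ x, F (θ : ℝ) x = a x) ∧
      c = max ‖G₀‖ ‖G₁‖)
    (by
      rintro a c ⟨F, G₀, G₁, -, -, rfl⟩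
      positivity)
    ⟨0, 0, 0, ⟨diffContOnCl_const, ⟨0, by simp⟩, by simp, by simp⟩, by simp, by simp⟩
    (by
      rintro a b c d ⟨F, G₀, G₁, ⟨h1, ⟨C, h2⟩, h3, h4⟩, hF, rfl⟩
        ⟨F', G₀', G₁', ⟨h1', ⟨C', h2'⟩, h3', h4'⟩, hF', rfl⟩
      refine ⟨max ‖G₀ + G₀'‖ ‖G₁ + G₁'‖, ?_, F + F', G₀ + G₀', G₁ + G₁',
        ⟨h1.add h1', ⟨C + C', fun z hz hz' => ?_⟩, ?_, ?_⟩, ?_, rfl⟩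
      · refine max_le ((norm_add_le _ _).trans ?_) ((norm_add_le _ _).trans ?_)
        · exact add_le_add (le_max_left _ _) (le_max_left _ _)
        · exact add_le_add (le_max_right _ _) (le_max_right _ _)
      · exact (norm_add_le _ _).trans (add_le_add (h2 z hz hz') (h2' z hz hz'))
      · intro t x
        simp [h3, h3']
      · intro t x
        simp [h4, h4']
      · intro x
        simp [hF, hF'])
    (by
      rintro l a c ⟨F, G₀, G₁, ⟨h1, ⟨C, h2⟩, h3, h4⟩, hF, rfl⟩
      refine ⟨max ‖l • G₀‖ ‖l • G₁‖, ?_, l • F, l • G₀, l • G₁,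
        ⟨h1.const_smul l, ⟨‖l‖ * C, fun z hz hz' => ?_⟩, ?_, ?_⟩, ?_, rfl⟩
      · rw [norm_smul, norm_smul, mul_max_of_nonneg _ _ (norm_nonneg l)]
      · rw [Pi.smul_apply, norm_smul]
        exact mul_le_mul_of_nonneg_left (h2 z hz hz') (norm_nonneg l)
      · intro t x
        simp [h3]
      · intro t x
        simp [h4]
      · intro x
        simp [hF])
    (by
      intro x
      obtain ⟨C, hC0, hC⟩ := A.exists_eval_bound x
      obtain ⟨D, hD0, hD⟩ := B.exists_eval_bound x
      obtain ⟨E, hE0, hE⟩ := (A.sum B).exists_eval_bound x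
      refine ⟨C + D, by positivity, ?_⟩
      rintro a c ⟨F, G₀, G₁, ⟨h1, ⟨K, h2⟩, h3, h4⟩, hF, rfl⟩
      rw [← hF]
      have hm0 : 0 ≤ max ‖G₀‖ ‖G₁‖ := by positivity
      refine PhragmenLindelof.vertical_strip (f := fun z => F z x) (a := 0) (b := 1)
        ((((A.sum B).evalCLM x).differentiable.diffContOnCl (s := Set.univ)).comp h1
          (fun _ _ => Set.mem_univ _)) ?_ ?_ ?_ ?_ ?_
      · refine ⟨0, by positivity, 0, ?_⟩
        refine Asymptotics.IsBigO.of_bound (E * K) ?_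
        refine Filter.eventually_inf_principal.2 (Filter.Eventually.of_forall fun z hz => ?_)
        simp only [zero_mul, Real.exp_zero, norm_one, mul_one]
        exact (hE _).trans (mul_le_mul_of_nonneg_left (h2 z hz.1.le hz.2.le) hE0)
      · intro z hz
        have hz' : z = (z.im : ℂ) * Complex.I := by
          apply Complex.ext <;> simp [hz]
        rw [hz', h3]
        refine (hC _).trans ?_
        have h5 := (norm_coe_le G₀ z.im).trans (le_max_left ‖G₀‖ ‖G₁‖)
        nlinarith [mul_le_mul_of_nonneg_left h5 hC0, mul_nonneg hD0 hm0]
      · intro z hz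
        have hz' : z = 1 + (z.im : ℂ) * Complex.I := by
          apply Complex.ext <;> simp [hz]
        rw [hz', h4]
        refine (hD _).trans ?_
        have h5 := (norm_coe_le G₁ z.im).trans (le_max_right ‖G₀‖ ‖G₁‖)
        nlinarith [mul_le_mul_of_nonneg_left h5 hD0, mul_nonneg hC0 hm0]
      · simpa using θ.2.1
      · simpa using θ.2.2)

end NormedFunctionSpace

/-! ### Weak products, Hankel symbols and the `H^p` scale of a reproducing kernel Hilbert space -/

section HpScale

variable {X : Type*} (H : Type*) [NormedAddCommGroup H] [InnerProductSpace ℂ H] [CompleteSpace H]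
  [RKHS ℂ H X ℂ]

/-- The weak product `H ⊙ H`: the functions `∑ fₙ gₙ` with `∑ ‖fₙ‖ ‖gₙ‖ < ∞`; the norm is the
infimum of `∑ ‖fₙ‖ ‖gₙ‖` over all such representations. -/
def weakProduct : NormedFunctionSpace X :=
  NormedFunctionSpace.ofCost
    (fun h c => ∃ f g : ℕ → H, HasSum (fun n => ‖f n‖ * ‖g n‖) c ∧
      ∀ x, HasSum (fun n => f n x * g n x) (h x))
    (by
      rintro h c ⟨f, g, hc, -⟩
      exact hc.nonneg fun n => by positivity)
    ⟨0, 0, by simp, fun x => by simp⟩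
    (by
      rintro h h' c d ⟨f, g, hc, hh⟩ ⟨f', g', hd, hh'⟩
      let e : ℕ ≃ ℕ ⊕ ℕ := Equiv.natSumNatEquivNat.symm
      refine ⟨c + d, le_rfl, fun n => Sum.elim f f' (e n), fun n => Sum.elim g g' (e n), ?_,
        fun x => ?_⟩
      · refine (e.hasSum_iff (f := fun s => ‖Sum.elim f f' s‖ * ‖Sum.elim g g' s‖)).2 ?_
        exact HasSum.sum hc hd
      · refine (e.hasSum_iff (f := fun s => Sum.elim f f' s x * Sum.elim g g' s x)).2 ?_
        exact HasSum.sum (hh x) (hh' x))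
    (by
      rintro l h c ⟨f, g, hc, hh⟩
      refine ⟨‖l‖ * c, le_rfl, fun n => l • f n, g, ?_, fun x => ?_⟩
      · simpa only [norm_smul, mul_assoc] using hc.mul_left ‖l‖
      · simpa [mul_assoc] using (hh x).mul_left l)
    (by
      intro x
      refine ⟨√‖RKHS.kernel H x x‖ * √‖RKHS.kernel H x x‖, by positivity, ?_⟩
      rintro h c ⟨f, g, hc, hh⟩
      rw [← (hh x).tsum_eq]
      refine tsum_of_norm_bounded (hc.mul_left _) fun n => ?_
      rw [norm_mul]
      calc ‖f n x‖ * ‖g n x‖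
          ≤ (‖f n‖ * √‖RKHS.kernel H x x‖) * (‖g n‖ * √‖RKHS.kernel H x x‖) := by
            gcongr <;> exact RKHS.norm_apply_le _ _
        _ = _ := by ring)

/-- `T` annihilates the kernel of `ρ : H ⊗_π H → H ⊙ H`, `∑ fₙ ⊗ gₙ ↦ ∑ fₙ gₙ`.

A bounded linear operator `T` from `H` to the complex conjugate space of `H` is encoded by the
bounded conjugate linear operator `f ↦ conj (T f)` on `H`, which has the same norm. The pairing
of the operator with `f ⊗ g`, which is the inner product of `T f` with `conj g` (linear in the
first argument) in the conjugate space, is then `⟪conj (T f), g⟫`, with Mathlib's inner product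
(linear in the second argument). -/
def AnnihilatesKer (T : H →L⋆[ℂ] H) : Prop :=
  ∀ f g : ℕ → H, Summable (fun n => ‖f n‖ * ‖g n‖) → (∀ x, HasSum (fun n => f n x * g n x) 0) →
    HasSum (fun n => inner ℂ (T (f n)) (g n)) 0

/-- `Han`: the functions `b = conj (T 1)`, where `T` runs through the bounded operators from `H` to
its complex conjugate that annihilate the kernel of `ρ`; the norm of `b` is the norm of the
Hankel operator `T = H_b`. (That operator is unique if the multipliers are
dense in `H`, so the infimum over all `T` is over one operator.) The
assumption is that `H` contains the constant function `1`. -/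
def han (h1 : ∃ e : H, ∀ x, e x = 1) : NormedFunctionSpace X :=
  NormedFunctionSpace.ofCost
    (fun b c => ∃ T : H →L⋆[ℂ] H, AnnihilatesKer H T ∧ (∀ x, T h1.choose x = b x) ∧ c = ‖T‖)
    (by
      rintro b c ⟨T, -, -, rfl⟩
      positivity)
    ⟨0, fun f g _ _ => by simp, by simp, by simp⟩
    (by
      rintro b b' c d ⟨T, hT, hb, rfl⟩ ⟨T', hT', hb', rfl⟩
      refine ⟨‖T + T'‖, norm_add_le _ _, T + T', fun f g hfg h0 => ?_, fun x => ?_, rfl⟩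
      · simpa [inner_add_left] using (hT f g hfg h0).add (hT' f g hfg h0)
      · simp [hb, hb'])
    (by
      rintro l b c ⟨T, hT, hb, rfl⟩
      refine ⟨‖l • T‖, (norm_smul l T).le, l • T, fun f g hfg h0 => ?_, fun x => ?_, rfl⟩
      · simpa [inner_smul_left, mul_comm] using (hT f g hfg h0).mul_left (starRingEnd ℂ l)
      · simp [hb])
    (by
      intro x
      refine ⟨‖h1.choose‖ * √‖RKHS.kernel H x x‖, by positivity, ?_⟩
      rintro b c ⟨T, -, hb, rfl⟩
      rw [← hb]
      calc ‖T h1.choose x‖ ≤ ‖T h1.choose‖ * √‖RKHS.kernel H x x‖ := RKHS.norm_apply_le _ _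
        _ ≤ (‖T‖ * ‖h1.choose‖) * √‖RKHS.kernel H x x‖ := by
            gcongr
            exact T.le_opNorm _
        _ = _ := by ring)

/-- `H^p = [H ⊙ H, Han]_[θ]` with `θ = (p - 1) / p`, for `1 ≤ p < ∞`. -/
def hardyScale (h1 : ∃ e : H, ∀ x, e x = 1) (p : ℝ) (hp : 1 ≤ p) : NormedFunctionSpace X :=
  (weakProduct H).interpolation (han H h1)
    ⟨(p - 1) / p, div_nonneg (by linarith) (by linarith), (div_le_one (by linarith)).2 (by linarith)⟩

end HpScale

/-! ### The Drury-Arveson kernel and the Szegő kernel -/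

/-- A scalar kernel `k` as a matrix of operators on `ℂ`. -/
def scalarKernel {X : Type*} (k : X → X → ℂ) : Matrix X X (ℂ →L[ℂ] ℂ) :=
  .of fun x y => k x y • ContinuousLinearMap.id ℂ ℂ

/-- The Drury-Arveson kernel `S(z, w) = 1 / (1 - ⟨z, w⟩)` on the open unit ball of `E`, where
`⟨z, w⟩` is linear in `z`. -/
def druryArvesonKernel (E : Type*) [NormedAddCommGroup E] [InnerProductSpace ℂ E]
    (z w : Metric.ball (0 : E) 1) : ℂ :=
  1 / (1 - inner ℂ (w : E) (z : E))

/-- The Szegő kernel `s(z, w) = 1 / (1 - z conj(w))` on the open unit disc. -/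
def szegoKernel (z w : Metric.ball (0 : ℂ) 1) : ℂ :=
  1 / (1 - (z : ℂ) * starRingEnd ℂ (w : ℂ))

theorem szegoKernel_eq : szegoKernel = druryArvesonKernel ℂ := by
  funext z w
  simp [szegoKernel, druryArvesonKernel]

section Positivity

open scoped ComplexOrder Matrix

theorem scalarKernel_posSemidef {X : Type*} {k : X → X → ℂ}
    (hk : (Matrix.of k).PosSemidef) : (scalarKernel k).PosSemidef := by
  have hherm : ∀ x y, starRingEnd ℂ (k y x) = k x y := fun x y => hk.isHermitian.apply x y
  have htfae : (scalarKernel k).PosSemidef ↔ (scalarKernel k).IsHermitian ∧ ∀ vv : X →₀ ℂ,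
      0 ≤ RCLike.re (vv.sum fun x w => vv.sum fun x' w' => inner ℂ (scalarKernel k x' x w) w') :=
    RKHS.posSemidef_tfae.out 0 2
  refine htfae.2 ⟨?_, fun c => ?_⟩
  · ext x y
    have hid : ContinuousLinearMap.adjoint (ContinuousLinearMap.id ℂ ℂ) =
        ContinuousLinearMap.id ℂ ℂ :=
      ContinuousLinearMap.ext fun z => ext_inner_right ℂ fun w => by
        rw [ContinuousLinearMap.adjoint_inner_left]
        rfl
    simp [scalarKernel, Matrix.conjTranspose_apply, ContinuousLinearMap.star_eq_adjoint, hherm, hid]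
  · have h := (Complex.le_def.1 (hk.2 c)).1
    convert! h using 2
    refine Finset.sum_congr rfl fun x _ => Finset.sum_congr rfl fun y _ => ?_
    simp [scalarKernel, hherm]
    ring

theorem gram_posSemidef {X E : Type*} [NormedAddCommGroup E] [InnerProductSpace ℂ E] (v : X → E) :
    (Matrix.gram ℂ v).PosSemidef := by
  refine ⟨Matrix.isHermitian_gram ℂ v, fun c => ?_⟩
  have h : (c.sum fun i xi => c.sum fun j xj => star xi * Matrix.gram ℂ v i j * xj) =
      inner ℂ (∑ i ∈ c.support, c i • v i) (∑ i ∈ c.support, c i • v i) := by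
    rw [Finsupp.sum, sum_inner]
    refine Finset.sum_congr rfl fun x _ => ?_
    rw [inner_sum]
    refine Finset.sum_congr rfl fun y _ => ?_
    change star (c x) * inner ℂ (v x) (v y) * c y = _
    rw [inner_smul_left, inner_smul_right, RCLike.star_def]
    ring
  rw [h, inner_self_eq_norm_sq_to_K]
  simp

theorem druryArveson_posSemidef (E : Type*) [NormedAddCommGroup E] [InnerProductSpace ℂ E] :
    (scalarKernel (druryArvesonKernel E)).PosSemidef := by
  refine scalarKernel_posSemidef ?_
  let G : Matrix (Metric.ball (0 : E) 1) (Metric.ball (0 : E) 1) ℂ :=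
    .of fun z w => inner ℂ (w : E) (z : E)
  have hG : G.PosSemidef :=
    (gram_posSemidef fun z : Metric.ball (0 : E) 1 => (z : E)).transpose
  have hpow : ∀ n : ℕ, (Matrix.of fun z w => G z w ^ n).PosSemidef := by
    intro n
    induction n with
    | zero =>
      convert! gram_posSemidef fun _ : Metric.ball (0 : E) 1 => (1 : ℂ) using 1
      ext z w
      simp [Matrix.gram]
    | succ n ih =>
      convert! ih.hadamard hG using 1
  have hsum : ∀ z w, HasSum (fun n => G z w ^ n) (druryArvesonKernel E z w) := by
    intro z w
    have hz : ‖(z : E)‖ < 1 := mem_ball_zero_iff.1 z.2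
    have hw : ‖(w : E)‖ < 1 := mem_ball_zero_iff.1 w.2
    have h : ‖G z w‖ < 1 := by
      refine (norm_inner_le_norm (𝕜 := ℂ) (w : E) (z : E)).trans_lt ?_
      nlinarith [norm_nonneg (z : E), norm_nonneg (w : E)]
    rw [druryArvesonKernel, one_div]
    exact hasSum_geometric_of_norm_lt_one h
  refine ⟨?_, fun c => ?_⟩
  · ext z w
    simp [druryArvesonKernel]
  · have h : HasSum (fun n : ℕ => c.sum fun i xi => c.sum fun j xj => star xi * G i j ^ n * xj)
        (c.sum fun i xi => c.sum fun j xj => star xi * druryArvesonKernel E i j * xj) :=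
      hasSum_sum fun i _ => hasSum_sum fun j _ => ((hsum i j).mul_left _).mul_right _
    exact h.nonneg fun n => (hpow n).2 c

end Positivity

instance (E : Type*) [NormedAddCommGroup E] [InnerProductSpace ℂ E] :
    Fact (scalarKernel (druryArvesonKernel E)).PosSemidef :=
  ⟨druryArveson_posSemidef E⟩

instance : Fact (scalarKernel szegoKernel).PosSemidef :=
  ⟨szegoKernel_eq ▸ druryArveson_posSemidef ℂ⟩

/-- The Drury-Arveson space: the reproducing kernel Hilbert space with the Drury-Arveson kernel. -/
abbrev DruryArvesonSpace (E : Type*) [NormedAddCommGroup E] [InnerProductSpace ℂ E] :=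
  RKHS.OfKernel (scalarKernel (druryArvesonKernel E))

/-- The Hardy space `H^2` of the disc: the reproducing kernel Hilbert space with the Szegő kernel. -/
abbrev SzegoSpace := RKHS.OfKernel (scalarKernel szegoKernel)

theorem druryArveson_one (E : Type*) [NormedAddCommGroup E] [InnerProductSpace ℂ E] :
    ∃ e : DruryArvesonSpace E, ∀ z, e z = 1 :=
  ⟨RKHS.kerFun (DruryArvesonSpace E) ⟨0, by simp⟩ 1, fun z => by
    rw [RKHS.kerFun_apply, RKHS.OfKernel.kernel_ofKernel]
    simp [scalarKernel, druryArvesonKernel]⟩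

theorem szego_one : ∃ e : SzegoSpace, ∀ z, e z = 1 :=
  ⟨RKHS.kerFun SzegoSpace ⟨0, by simp⟩ 1, fun z => by
    rw [RKHS.kerFun_apply, RKHS.OfKernel.kernel_ofKernel]
    simp [scalarKernel, szegoKernel]⟩

/-- The space `ℓ²(d)` over an index set `ι` of cardinality `d`. -/
abbrev EllTwo (ι : Type*) := lp (fun _ : ι => ℂ) 2

/-- The restriction of `Q : z ↦ ⟨z, v⟩` to the open unit ball, as a map to the unit disc. -/
def sliceMap {E : Type*} [NormedAddCommGroup E] [InnerProductSpace ℂ E] (v : E) (hv : ‖v‖ = 1)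
    (z : Metric.ball (0 : E) 1) : Metric.ball (0 : ℂ) 1 :=
  ⟨inner ℂ v (z : E), by
    have h := norm_inner_le_norm (𝕜 := ℂ) v (z : E)
    have hz : ‖(z : E)‖ < 1 := mem_ball_zero_iff.1 z.2
    rw [hv, one_mul] at h
    simpa using h.trans_lt hz⟩

end

/-!
Let `R : λ ↦ λ v` be the embedding of the disc into the ball as a slice, so that `Q ∘ R = id`. The
kernels satisfy `S(z, R λ) = s(Q z, λ)`, hence the isometry `H²(𝔻) → DruryArveson` that sends `s_λ`
to `S_{R λ}` is composition with `Q`, and its adjoint is composition with `R`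
(`RKHS.exists_contractive_comp_adjoint`).

Now let `A : H → K` and `B : K → H` be contractions between reproducing kernel Hilbert spaces that
are adjoint to each other and are the compositions with maps `φ` and `ψ`. Then composition with `φ`
is a contraction `H ⊙ H → K ⊙ K` (apply `A` to both factors), and also a contraction
`Han(H) → Han(K)`: the Hankel operator `T` of `b` is sent to `A T B`, which annihilates the kernel
of `ρ` because `⟪A T B f, g⟫ = ⟪T (B f), B g⟫` and `B` preserves the relation `∑ fₙ gₙ = 0`, and
whose symbol is `A T 1 = b ∘ φ`. By functoriality of the complex method, composition with `φ` is a
contraction on the interpolation spaces as well.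

This applies to the pair `(Q, R)` and, exchanging the roles of `A` and `B`, to the pair `(R, Q)`.
Composition with `Q` is therefore a contraction with a contractive left inverse, i.e. an isometry,
and `f ↦ f ∘ R ∘ Q` is a contractive projection onto its range.
-/

/-! ### Contractive composition maps between normed function spaces -/

namespace NormedFunctionSpace

variable {X Y : Type*}

/-- Composition with `φ : Y → X` maps `A` into `B` and does not increase the norm. -/
def CompContractive (φ : Y → X) (A : NormedFunctionSpace X) (B : NormedFunctionSpace Y) : Prop :=
  ∀ f : A.Elem, ∃ g : B.Elem, (∀ y, g y = f (φ y)) ∧ ‖g‖ ≤ ‖f‖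

namespace CompContractive

variable {φ : Y → X} {A : NormedFunctionSpace X} {B : NormedFunctionSpace Y}

/-- The composition map `f ↦ f ∘ φ` as a bounded linear operator from `A` to `B`. -/
noncomputable def toCLM (h : CompContractive φ A B) : A.Elem →L[ℂ] B.Elem :=
  LinearMap.mkContinuous
    { toFun := fun f => (h f).choose
      map_add' := fun f g => Elem.ext fun y => by
        rw [(h (f + g)).choose_spec.1, add_apply, add_apply, (h f).choose_spec.1,
          (h g).choose_spec.1]
      map_smul' := fun c f => Elem.ext fun y => by
        rw [(h (c • f)).choose_spec.1, RingHom.id_apply, smul_apply, smul_apply,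
          (h f).choose_spec.1] }
    1 fun f => by simpa using (h f).choose_spec.2

@[simp]
theorem toCLM_apply (h : CompContractive φ A B) (f : A.Elem) (y : Y) : h.toCLM f y = f (φ y) :=
  (h f).choose_spec.1 y

theorem norm_toCLM_apply_le (h : CompContractive φ A B) (f : A.Elem) : ‖h.toCLM f‖ ≤ ‖f‖ :=
  (h f).choose_spec.2

/-- If composition with `φ` does not increase the cost of representations, then it does not increase
the norms that these costs define. -/
theorem ofCost {R : (X → ℂ) → ℝ → Prop} {R' : (Y → ℂ) → ℝ → Prop} {n z a s e n' z' a' s' e'}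
    (h : ∀ f c, R f c → ∃ d ≤ c, R' (fun y => f (φ y)) d) :
    CompContractive φ (NormedFunctionSpace.ofCost R n z a s e)
      (NormedFunctionSpace.ofCost R' n' z' a' s' e') := by
  rintro ⟨f, c₀, hc₀⟩
  obtain ⟨d₀, -, hd₀⟩ := h f c₀ hc₀
  refine ⟨⟨fun y => f (φ y), d₀, hd₀⟩, fun y => rfl, ?_⟩
  refine le_csInf ⟨c₀, hc₀⟩ fun c hc => ?_
  obtain ⟨d, hdc, hd⟩ := h f c hc
  exact (csInf_le ⟨0, fun c hc => n' _ c hc⟩ hd).trans hdc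

theorem sum {A' : NormedFunctionSpace X} {B' : NormedFunctionSpace Y}
    (h : CompContractive φ A B) (h' : CompContractive φ A' B') :
    CompContractive φ (A.sum A') (B.sum B') := by
  refine CompContractive.ofCost ?_
  rintro f c ⟨a, b, hf, rfl⟩
  refine ⟨‖h.toCLM a‖ + ‖h'.toCLM b‖,
    add_le_add (h.norm_toCLM_apply_le a) (h'.norm_toCLM_apply_le b), h.toCLM a, h'.toCLM b,
    fun y => by simp [hf], rfl⟩

/-- Composing a `C₀` function of a real variable with a contractive composition map. -/
theorem exists_zeroAtInfty (h : CompContractive φ A B) (G : ZeroAtInftyContinuousMap ℝ A.Elem) :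
    ∃ G' : ZeroAtInftyContinuousMap ℝ B.Elem, (∀ t, G' t = h.toCLM (G t)) ∧ ‖G'‖ ≤ ‖G‖ := by
  let G' : ZeroAtInftyContinuousMap ℝ B.Elem :=
    { toFun := fun t => h.toCLM (G t)
      continuous_toFun := h.toCLM.continuous.comp (map_continuous G)
      zero_at_infty' := by
        have := (h.toCLM.continuous.tendsto 0).comp (zero_at_infty G)
        rwa [map_zero] at this }
  refine ⟨G', fun t => rfl, ?_⟩
  rw [← ZeroAtInftyContinuousMap.norm_toBCF_eq_norm]
  exact (BoundedContinuousFunction.norm_le (norm_nonneg G)).2 fun t =>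
    (h.norm_toCLM_apply_le (G t)).trans (norm_coe_le G t)

/-- The complex method of interpolation is functorial. -/
theorem interpolation {A' : NormedFunctionSpace X} {B' : NormedFunctionSpace Y}
    (h : CompContractive φ A B) (h' : CompContractive φ A' B') (θ : unitInterval) :
    CompContractive φ (A.interpolation A' θ) (B.interpolation B' θ) := by
  refine CompContractive.ofCost ?_
  rintro f c ⟨F, G₀, G₁, ⟨hF, ⟨C, hC⟩, h₀, h₁⟩, hθ, rfl⟩
  obtain ⟨G₀', hG₀, hn₀⟩ := h.exists_zeroAtInfty G₀
  obtain ⟨G₁', hG₁, hn₁⟩ := h'.exists_zeroAtInfty G₁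
  let L := (h.sum h').toCLM
  refine ⟨max ‖G₀'‖ ‖G₁'‖, max_le_max hn₀ hn₁, fun z => L (F z), G₀', G₁', ⟨?_, ⟨C, ?_⟩, ?_, ?_⟩,
    fun y => ?_, rfl⟩
  · exact (L.differentiable.diffContOnCl (s := Set.univ)).comp hF fun _ _ => Set.mem_univ _
  · exact fun z hz hz' => ((h.sum h').norm_toCLM_apply_le _).trans (hC z hz hz')
  · intro t y
    simp [L, hG₀, h₀]
  · intro t y
    simp [L, hG₁, h₁]
  · simp [L, hθ]

/-- If composition with a left inverse `Q` of `R` and composition with `R` are both contractive, then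
composition with `Q` is an isometry onto a complemented subspace. -/
theorem exists_linearIsometry {Q : Y → X} {R : X → Y} (hQR : ∀ x, Q (R x) = x)
    (hQ : CompContractive Q A B) (hR : CompContractive R B A) :
    ∃ V : A.Elem →ₗᵢ[ℂ] B.Elem, (∀ f y, V f y = f (Q y)) ∧
      (LinearMap.range V.toLinearMap).ClosedComplemented := by
  have hinv : ∀ f, hR.toCLM (hQ.toCLM f) = f := fun f => Elem.ext fun x => by simp [hQR]
  refine ⟨⟨hQ.toCLM.toLinearMap, fun f => (hQ.norm_toCLM_apply_le f).antisymm ?_⟩,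
    fun f y => hQ.toCLM_apply f y, ?_⟩
  · have := hR.norm_toCLM_apply_le (hQ.toCLM f)
    rwa [hinv] at this
  · refine ⟨(hQ.toCLM.comp hR.toCLM).codRestrict _ fun g => ⟨hR.toCLM g, rfl⟩, ?_⟩
    rintro ⟨_, f, rfl⟩
    exact Subtype.ext (congrArg hQ.toCLM (hinv f))

end CompContractive

end NormedFunctionSpace

/-! ### Composition on weak products, Hankel symbols and the `H^p` scale -/

theorem ContinuousLinearMap.norm_apply_mul_norm_apply_le {E F : Type*} [NormedAddCommGroup E]
    [NormedSpace ℂ E] [NormedAddCommGroup F] [NormedSpace ℂ F] {A : E →L[ℂ] F} (hA : ‖A‖ ≤ 1)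
    (f g : E) : ‖A f‖ * ‖A g‖ ≤ ‖f‖ * ‖g‖ := by
  have h := fun f => A.le_of_opNorm_le hA f
  simp only [one_mul] at h
  gcongr <;> apply h

/-- Compressing a Hankel operator along an adjoint pair of composition operators gives a Hankel
operator. -/
theorem AnnihilatesKer.compress {X Y H K : Type*} [NormedAddCommGroup H] [InnerProductSpace ℂ H]
    [RKHS ℂ H X ℂ] [NormedAddCommGroup K] [InnerProductSpace ℂ K] [RKHS ℂ K Y ℂ] {ψ : X → Y}
    {A : H →L[ℂ] K} {B : K →L[ℂ] H} (hB1 : ‖B‖ ≤ 1) (hB : ∀ g x, B g x = g (ψ x))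
    (hAB : ∀ f g, inner ℂ (A f) g = inner ℂ f (B g)) {T : H →L⋆[ℂ] H} (hT : AnnihilatesKer H T) :
    AnnihilatesKer K (A.comp (T.comp B)) := by
  intro f g hs h0
  have hs' : Summable fun n => ‖B (f n)‖ * ‖B (g n)‖ :=
    hs.of_nonneg_of_le (fun n => by positivity) fun n =>
      ContinuousLinearMap.norm_apply_mul_norm_apply_le hB1 _ _
  simpa [hAB] using hT (fun n => B (f n)) (fun n => B (g n)) hs'
    fun x => by simpa only [hB] using h0 (ψ x)

section HpScale

open NormedFunctionSpace

variable {X Y : Type*} {H K : Type*} [NormedAddCommGroup H] [InnerProductSpace ℂ H]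
  [CompleteSpace H] [RKHS ℂ H X ℂ] [NormedAddCommGroup K] [InnerProductSpace ℂ K]
  [CompleteSpace K] [RKHS ℂ K Y ℂ] {φ : Y → X} {ψ : X → Y} {A : H →L[ℂ] K} {B : K →L[ℂ] H}

theorem compContractive_weakProduct (hA1 : ‖A‖ ≤ 1) (hA : ∀ f y, A f y = f (φ y)) :
    CompContractive φ (weakProduct H) (weakProduct K) := by
  refine CompContractive.ofCost ?_
  rintro h c ⟨f, g, hc, hh⟩
  have hle : ∀ n, ‖A (f n)‖ * ‖A (g n)‖ ≤ ‖f n‖ * ‖g n‖ := fun n =>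
    ContinuousLinearMap.norm_apply_mul_norm_apply_le hA1 _ _
  have hs : Summable fun n => ‖A (f n)‖ * ‖A (g n)‖ :=
    hc.summable.of_nonneg_of_le (fun n => by positivity) hle
  refine ⟨∑' n, ‖A (f n)‖ * ‖A (g n)‖, ?_, fun n => A (f n), fun n => A (g n), hs.hasSum,
    fun y => by simpa only [hA] using hh (φ y)⟩
  exact hasSum_le hle hs.hasSum hc

/-- A Hankel operator `T` with symbol `b` is sent to `A T B`, whose symbol is `A T (B 1) = b ∘ φ`
because `B 1 = 1`. -/
theorem compContractive_han (hA1 : ‖A‖ ≤ 1) (hB1 : ‖B‖ ≤ 1) (hA : ∀ f y, A f y = f (φ y))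
    (hB : ∀ g x, B g x = g (ψ x)) (hAB : ∀ f g, inner ℂ (A f) g = inner ℂ f (B g))
    (h1 : ∃ e : H, ∀ x, e x = 1) (h1' : ∃ e : K, ∀ y, e y = 1) :
    CompContractive φ (han H h1) (han K h1') := by
  refine CompContractive.ofCost ?_
  rintro b c ⟨T, hT, hb, rfl⟩
  have hone : B h1'.choose = h1.choose := RKHS.ext fun x => by
    rw [hB, h1'.choose_spec, h1.choose_spec]
  refine ⟨_, ?_, A.comp (T.comp B), hT.compress hB1 hB hAB, fun y => ?_, rfl⟩
  · calc ‖A.comp (T.comp B)‖ ≤ ‖A‖ * (‖T‖ * ‖B‖) :=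
          (A.opNorm_comp_le _).trans (by gcongr; exact T.opNorm_comp_le B)
      _ ≤ 1 * (‖T‖ * 1) := by gcongr
      _ = ‖T‖ := by ring
  · simp [hone, hA, hb]

theorem compContractive_hardyScale (hA1 : ‖A‖ ≤ 1) (hB1 : ‖B‖ ≤ 1)
    (hA : ∀ f y, A f y = f (φ y)) (hB : ∀ g x, B g x = g (ψ x))
    (hAB : ∀ f g, inner ℂ (A f) g = inner ℂ f (B g))
    (h1 : ∃ e : H, ∀ x, e x = 1) (h1' : ∃ e : K, ∀ y, e y = 1) (p : ℝ) (hp : 1 ≤ p) :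
    CompContractive φ (hardyScale H h1 p hp) (hardyScale K h1' p hp) :=
  (compContractive_weakProduct hA1 hA).interpolation (compContractive_han hA1 hB1 hA hB hAB h1 h1') _

end HpScale

/-! ### The isometry between reproducing kernel Hilbert spaces induced by a slice -/

section Slice

variable {X Y : Type*} {H K : Type*} [NormedAddCommGroup H] [InnerProductSpace ℂ H]
  [CompleteSpace H] [RKHS ℂ H X ℂ] [NormedAddCommGroup K] [InnerProductSpace ℂ K]
  [CompleteSpace K] [RKHS ℂ K Y ℂ]

variable (H) in
theorem RKHS.denseRange_linearCombination_kerFun :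
    DenseRange (Finsupp.linearCombination ℂ fun x => RKHS.kerFun H x (1 : ℂ)) := by
  have h := RKHS.kerFun_dense H
  have hspan : Submodule.span ℂ {RKHS.kerFun H x v | (x) (v)} =
      LinearMap.range (Finsupp.linearCombination ℂ fun x => RKHS.kerFun H x (1 : ℂ)) := by
    rw [Finsupp.range_linearCombination]
    refine le_antisymm (Submodule.span_le.2 ?_) (Submodule.span_mono ?_)
    · rintro _ ⟨x, v, rfl⟩
      have hv : RKHS.kerFun H x v = v • RKHS.kerFun H x (1 : ℂ) := by
        rw [← map_smul, smul_eq_mul, mul_one]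
      rw [hv]
      exact Submodule.smul_mem _ _ (Submodule.subset_span ⟨x, rfl⟩)
    · rintro _ ⟨x, rfl⟩
      exact ⟨x, 1, rfl⟩
  rw [hspan, ← Submodule.dense_iff_topologicalClosure_eq_top] at h
  exact h

/-- If `k_K(y, R x) = k_H(Q y, x)` and `Q ∘ R = id`, then composition with `Q` is a contraction
`H → K` (in fact an isometry), with adjoint the composition with `R`. It is the extension by
continuity of the map that sends the kernel function at `x` to the kernel function at `R x`. -/
theorem RKHS.exists_contractive_comp_adjoint {Q : Y → X} {R : X → Y} (hQR : ∀ x, Q (R x) = x)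
    (hker : ∀ y x, RKHS.kernel K y (R x) 1 = RKHS.kernel H (Q y) x 1) :
    ∃ (A : H →L[ℂ] K) (B : K →L[ℂ] H), ‖A‖ ≤ 1 ∧ ‖B‖ ≤ 1 ∧ (∀ f y, A f y = f (Q y)) ∧
      (∀ g x, B g x = g (R x)) ∧ ∀ f g, inner ℂ (A f) g = inner ℂ f (B g) := by
  let e := Finsupp.linearCombination ℂ fun x => RKHS.kerFun H x (1 : ℂ)
  let j := Finsupp.linearCombination ℂ fun x => RKHS.kerFun K (R x) (1 : ℂ)
  have he : DenseRange e := RKHS.denseRange_linearCombination_kerFun H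
  -- On finite combinations of kernel functions, `j` is composition with `Q`; this is `hker`.
  have hj : ∀ c y, j c y = e c (Q y) := fun c y => by
    induction c using Finsupp.induction_linear with
    | zero => simp
    | add c d hc hd => simp [hc, hd]
    | single x a => simp [e, j, RKHS.kerFun_apply, hker]
  have hinner : ∀ c, inner ℂ (j c) (j c) = inner ℂ (e c) (e c) := fun c => by
    suffices h : ∀ d, inner ℂ (j c) (j d) = inner ℂ (e c) (e d) from h c
    intro d
    induction d using Finsupp.induction_linear with
    | zero => simp
    | add d d' hd hd' => simp [hd, hd']
    | single x a =>
      simp [hj, hQR, show j (.single x a) = a • RKHS.kerFun K (R x) 1 by simp [j],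
        show e (.single x a) = a • RKHS.kerFun H x 1 by simp [e]]
  have hnorm : ∀ c, ‖j c‖ ≤ 1 * ‖e c‖ := fun c => by
    rw [one_mul, norm_eq_sqrt_re_inner (𝕜 := ℂ) (j c), hinner, ← norm_eq_sqrt_re_inner]
  let A : H →L[ℂ] K := j.extendOfNorm e
  have hA1 : ‖A‖ ≤ 1 := LinearMap.opNorm_extendOfNorm_le he zero_le_one hnorm
  have hAe : ∀ c, A (e c) = j c := LinearMap.extendOfNorm_eq he ⟨1, hnorm⟩
  have hAker : ∀ x, A (RKHS.kerFun H x 1) = RKHS.kerFun K (R x) 1 := fun x => by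
    simpa [e, j] using hAe (Finsupp.single x 1)
  refine ⟨A, ContinuousLinearMap.adjoint A, hA1, ?_, fun f y => ?_, fun g x => ?_, fun f g => ?_⟩
  · rwa [LinearIsometryEquiv.norm_map]
  · refine he.induction_on (p := fun f => A f y = f (Q y)) f
      (isClosed_eq ((RKHS.continuous_eval y).comp A.continuous) (RKHS.continuous_eval _)) ?_
    intro c
    rw [hAe, hj]
  · have h := ContinuousLinearMap.adjoint_inner_right A (RKHS.kerFun H x 1) g
    simpa [hAker] using h
  · rw [ContinuousLinearMap.adjoint_inner_right]

/-- The slice `λ ↦ λ v` of the unit ball, a right inverse of `sliceMap v`. -/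
def sliceEmbedding {E : Type*} [NormedAddCommGroup E] [InnerProductSpace ℂ E] (v : E)
    (hv : ‖v‖ = 1) (l : Metric.ball (0 : ℂ) 1) : Metric.ball (0 : E) 1 :=
  ⟨(l : ℂ) • v, by simpa [norm_smul, hv] using mem_ball_zero_iff.1 l.2⟩

theorem sliceMap_sliceEmbedding {E : Type*} [NormedAddCommGroup E] [InnerProductSpace ℂ E] (v : E)
    (hv : ‖v‖ = 1) (l : Metric.ball (0 : ℂ) 1) : sliceMap v hv (sliceEmbedding v hv l) = l := by
  apply Subtype.ext
  simp [sliceMap, sliceEmbedding, inner_self_eq_norm_sq_to_K, hv]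

theorem druryArvesonKernel_sliceEmbedding {E : Type*} [NormedAddCommGroup E]
    [InnerProductSpace ℂ E] (v : E) (hv : ‖v‖ = 1) (z : Metric.ball (0 : E) 1)
    (l : Metric.ball (0 : ℂ) 1) :
    druryArvesonKernel E z (sliceEmbedding v hv l) = szegoKernel (sliceMap v hv z) l := by
  simp [druryArvesonKernel, szegoKernel, sliceMap, sliceEmbedding]

end Slice

theorem mainTheorem10 {ι : Type*} (v : EllTwo ι) (hv : ‖v‖ = 1) :
    (∀ (p : ℝ) (hp : 1 ≤ p),
      ∃ V : (hardyScale SzegoSpace szego_one p hp).Elem →ₗᵢ[ℂ]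
          (hardyScale (DruryArvesonSpace (EllTwo ι)) (druryArveson_one (EllTwo ι)) p hp).Elem,
        (∀ f z, V f z = f (sliceMap v hv z)) ∧
        (LinearMap.range V.toLinearMap).ClosedComplemented) ∧
    (∃ V : (han SzegoSpace szego_one).Elem →ₗᵢ[ℂ]
          (han (DruryArvesonSpace (EllTwo ι)) (druryArveson_one (EllTwo ι))).Elem,
        (∀ f z, V f z = f (sliceMap v hv z)) ∧
        (LinearMap.range V.toLinearMap).ClosedComplemented) := by
  obtain ⟨A, B, hA1, hB1, hA, hB, hAB⟩ := RKHS.exists_contractive_comp_adjoint (H := SzegoSpace)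
    (K := DruryArvesonSpace (EllTwo ι)) (sliceMap_sliceEmbedding v hv) fun z l => by
      rw [RKHS.OfKernel.kernel_ofKernel, RKHS.OfKernel.kernel_ofKernel]
      simp [scalarKernel, druryArvesonKernel_sliceEmbedding]
  have hBA : ∀ g f, inner ℂ (B g) f = inner ℂ g (A f) := fun g f => by
    rw [← inner_conj_symm, ← hAB, inner_conj_symm]
  have hQR := sliceMap_sliceEmbedding v hv
  refine ⟨fun p hp => ?_, ?_⟩
  · exact (compContractive_hardyScale hA1 hB1 hA hB hAB _ _ p hp).exists_linearIsometry hQR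
      (compContractive_hardyScale hB1 hA1 hB hA hBA _ _ p hp)
  · exact (compContractive_han hA1 hB1 hA hB hAB _ _).exists_linearIsometry hQR
      (compContractive_han hB1 hA1 hB hA hBA _ _)
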